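/- For an integer $n\ge 0$ put $n^-=\lfloor n/2\rfloor$ and $n^+=\lceil n/2\rceil$. For $d\ge 1$ and integers $s_1,\dots,s_d\ge 2$ let $$\mathfrak z_q^{\mathrm O}[s_1,\dots,s_d]=\sum_{k_1>\dots>k_d>0}\ \prod_{j=1}^d\frac{q^{k_js_j^+}+q^{k_js_j^-}}{(1-q^{k_j})^{s_j}},$$ regarded as a formal power series in $q$ with rational coefficients, and let $|\mathbf s|=s_1+\dots+s_d$. For $w\ge 0$ let $\mathbf Z^{\mathrm O}_{\le w}\subset\mathbb Q[[q]]$ be the $\mathbb Q$-vector space spanned by all $\mathfrak z_q^{\mathrm O}[\mathbf s]$ with $\mathbf s=(s_1,\dots,s_d)$, $d\ge 1$, all $s_j\ge 2$ and $|\mathbf s|\le w$. Then for every $0\le w\le 6$ the space $\mathbf Z^{\mathrm O}_{\le w}$ is finite-dimensional, and $\dim_{\mathbb Q}\mathbf Z^{\mathrm O}_{\le w}$ is the coefficient of $t^w$ in the power series expansion of $$\frac{1}{1-t-t^2+t^6+t^8-t^{13}}-\frac1{1-t}$$ (that is, the dimensions for $w=0,\dots,6$ are $0,0,1,2,4,7,11$).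 Moreover, $$4\,\mathfrak z_q^{\mathrm O}[6]=-\mathfrak z_q^{\mathrm O}[2,2]+12\,\mathfrak z_q^{\mathrm O}[3,3]-6\,\mathfrak z_q^{\mathrm O}[4,2].$$ -/

import Mathlib

open scoped PowerSeries.WithPiTopology

/-- The nonnegative integer `n⁻` with `(n - 1) / 2 ≤ n⁻ ≤ n / 2`. -/
def lowerHalf (n : ℕ) : ℕ := n / 2

/-- The nonnegative integer `n⁺` with `n / 2 ≤ n⁺ ≤ (n + 1) / 2`. -/
def upperHalf (n : ℕ) : ℕ := (n + 1) / 2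

/-- The index set of the nested sums of depth `d`: tuples `k₁ > k₂ > ⋯ > k_d > 0`. -/
abbrev NestedIndex (d : ℕ) : Type :=
  {k : Fin d → ℕ // StrictAnti k ∧ ∀ j, 0 < k j}

/-- The summand `∏ⱼ (q ^ (kⱼ sⱼ⁺) + q ^ (kⱼ sⱼ⁻)) / (1 - q ^ kⱼ) ^ sⱼ`, as a formal power series
in `q = PowerSeries.X`. As `kⱼ > 0`, the series `1 - q ^ kⱼ` is invertible. -/
noncomputable def okounkovTerm {d : ℕ} (s : Fin d → ℕ) (k : NestedIndex d) : PowerSeries ℚ :=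
  ∏ j, (PowerSeries.X ^ (k.1 j * upperHalf (s j)) + PowerSeries.X ^ (k.1 j * lowerHalf (s j))) *
    ((1 - PowerSeries.X ^ (k.1 j))⁻¹) ^ (s j)

/-- The (modified) type O `q`-multiple zeta value of the composition `s = (s₁, …, s_d)`: the sum of
`okounkovTerm s k` over all `k₁ > ⋯ > k_d > 0`, for the coefficientwise topology on `ℚ⟦q⟧`. -/
noncomputable def okounkovQMZV {d : ℕ} (s : Fin d → ℕ) : PowerSeries ℚ :=
  ∑' k : NestedIndex d, okounkovTerm s k

/-- The defining sum converges when all arguments are at least `2`: each coefficient receives only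
finitely many nonzero contributions. -/
theorem summable_okounkovTerm {d : ℕ} (s : Fin d → ℕ) (hs : ∀ j, 2 ≤ s j) :
    Summable (okounkovTerm s) := by
  rw [PowerSeries.WithPiTopology.summable_iff_summable_coeff]
  intro n
  have hfin : Set.Finite {k : NestedIndex d | ∀ j, k.1 j ≤ n} :=
    (Set.finite_Iic (fun _ : Fin d => n)).preimage Subtype.val_injective.injOn
  refine summable_of_ne_finset_zero (s := hfin.toFinset) fun k hk => ?_
  simp only [Set.Finite.mem_toFinset, Set.mem_ofPred_eq, not_forall, not_le] at hk
  obtain ⟨j, hj⟩ := hk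
  have hlow : 1 ≤ lowerHalf (s j) := by have := hs j; unfold lowerHalf; omega
  have hup : 1 ≤ upperHalf (s j) := by have := hs j; unfold upperHalf; omega
  have hdvd : (PowerSeries.X : PowerSeries ℚ) ^ (k.1 j) ∣ okounkovTerm s k := by
    refine dvd_trans (Dvd.dvd.mul_right (dvd_add ?_ ?_) _) (Finset.dvd_prod_of_mem _
      (Finset.mem_univ j))
    · exact pow_dvd_pow _ (Nat.le_mul_of_pos_right _ hup)
    · exact pow_dvd_pow _ (Nat.le_mul_of_pos_right _ hlow)
  exact PowerSeries.X_pow_dvd_iff.1 hdvd n hj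

/-- The `ℚ`-vector space generated by the type O values of all compositions of positive depth, with
all arguments at least `2`, of weight at most `w`. -/
noncomputable def okounkovSpace (w : ℕ) : Submodule ℚ (PowerSeries ℚ) :=
  Submodule.span ℚ {f | ∃ (d : ℕ) (s : Fin d → ℕ),
    0 < d ∧ (∀ j, 2 ≤ s j) ∧ ∑ j, s j ≤ w ∧ f = okounkovQMZV s}

/-- The series `1 / (1 - t - t² + t⁶ + t⁸ - t¹³) - 1 / (1 - t)`, expanded in powers of `t`. -/
noncomputable def okounkovSeries : PowerSeries ℚ :=
  (1 - PowerSeries.X - PowerSeries.X ^ 2 + PowerSeries.X ^ 6 + PowerSeries.X ^ 8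
    - PowerSeries.X ^ 13)⁻¹ - (1 - PowerSeries.X)⁻¹

/-! Expanding each factor gives `∑ₘ F_s(m) q^(km)` with `F_s = factorCoeff s`, polynomial in `m` for
the weights needed in the relation. A depth-two coefficient at `q^N` is then the sum of `F_a(m)
F_b(n)` over `km + ln = N`, `k > l`.

The relation comes from `km + ln = (k - l)m + l(m + n)`, which trades `k > l` for `m < n`. For
symmetric `H`, `two_mul_sum_sub_add` reduces the sum of `H(m, n) - H(m, m + n)` over `k > l` to the
diagonals `m = n` and `k = l`. With `H = -mn(m - n)²` the first vanishes and the second is a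
depth-one sum, namely the value at `[6]`.

So `[6]` is redundant among the compositions of weight at most 6. The other eleven values are
independent because their coefficients at `q, …, q^11` form a nonsingular matrix. Counting them by
weight gives the dimensions. -/

/-! ### Expansion of a single factor -/

open PowerSeries in
/-- The factor of `okounkovTerm` attached to the argument `s` and the index `k`. -/
noncomputable def okounkovFactor (s k : ℕ) : PowerSeries ℚ :=
  (X ^ (k * upperHalf s) + X ^ (k * lowerHalf s)) * ((1 - X ^ k)⁻¹) ^ s

/-- The coefficient of `t ^ m` in `(t ^ s⁺ + t ^ s⁻) / (1 - t) ^ s`. -/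
def factorCoeff (s m : ℕ) : ℕ :=
  (m + (s - 1 - upperHalf s)).choose (s - 1) + (m + (s - 1 - lowerHalf s)).choose (s - 1)

/-- The negative binomial series shifted by `a`. Since `a ≤ s - 1`, the binomial also vanishes for
`m < a`, so one formula covers every `m`. -/
lemma coeff_X_pow_mul_inv_one_sub_pow {s a : ℕ} (hs : 1 ≤ s) (ha : a ≤ s - 1) (m : ℕ) :
    PowerSeries.coeff m
        (PowerSeries.X ^ a * ((1 - PowerSeries.X : PowerSeries ℚ)⁻¹) ^ s : PowerSeries ℚ) =
      ((m + (s - 1 - a)).choose (s - 1) : ℕ) := by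
  obtain ⟨d, rfl⟩ : ∃ d, s = d + 1 := ⟨s - 1, by omega⟩
  have hinv : ((1 - PowerSeries.X : PowerSeries ℚ)⁻¹) = PowerSeries.mk 1 := by
    rw [PowerSeries.inv_eq_iff_mul_eq_one (by simp), PowerSeries.mk_one_mul_one_sub_eq_one]
  rw [hinv, PowerSeries.mk_one_pow_eq_mk_choose_add, PowerSeries.coeff_X_pow_mul']
  simp only [Nat.add_sub_cancel] at ha ⊢
  split_ifs with h
  · rw [PowerSeries.coeff_mk]
    congr 2
    omega
  · rw [Nat.choose_eq_zero_of_lt (by omega), Nat.cast_zero]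

lemma okounkovFactor_eq_expand (s : ℕ) {k : ℕ} (hk : k ≠ 0) :
    okounkovFactor s k = PowerSeries.expand k hk
      ((PowerSeries.X ^ upperHalf s + PowerSeries.X ^ lowerHalf s) *
        ((1 - PowerSeries.X)⁻¹) ^ s) := by
  have hinv : (1 - PowerSeries.X ^ k : PowerSeries ℚ)⁻¹ =
      PowerSeries.expand k hk (1 - PowerSeries.X)⁻¹ := by
    rw [PowerSeries.inv_eq_iff_mul_eq_one (by simp [hk])]
    have h : PowerSeries.expand k hk ((1 - PowerSeries.X : PowerSeries ℚ)⁻¹ *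
        (1 - PowerSeries.X)) = 1 := by
      rw [PowerSeries.inv_mul_cancel _ (by simp), map_one]
    rwa [map_mul, map_sub, map_one, PowerSeries.expand_X] at h
  simp [okounkovFactor, hinv, pow_mul]

lemma coeff_okounkovFactor {s : ℕ} (hs : 2 ≤ s) {k : ℕ} (hk : k ≠ 0) (n : ℕ) :
    PowerSeries.coeff n (okounkovFactor s k) = if k ∣ n then (factorCoeff s (n / k) : ℚ) else 0 := by
  rw [okounkovFactor_eq_expand s hk, PowerSeries.coeff_expand]
  refine if_congr Iff.rfl ?_ rfl
  rw [add_mul, map_add, coeff_X_pow_mul_inv_one_sub_pow (by omega) (by unfold upperHalf; omega),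
    coeff_X_pow_mul_inv_one_sub_pow (by omega) (by unfold lowerHalf; omega), factorCoeff]
  push_cast
  rfl

lemma coeff_okounkovFactor_mul {s : ℕ} (hs : 2 ≤ s) {k : ℕ} (hk : k ≠ 0) (f : PowerSeries ℚ)
    (n : ℕ) :
    PowerSeries.coeff n (okounkovFactor s k * f) = ∑ m ∈ Finset.range (n + 1),
      if k * m ≤ n then (factorCoeff s m : ℚ) * PowerSeries.coeff (n - k * m) f else 0 := by
  rw [PowerSeries.coeff_mul, Finset.Nat.sum_antidiagonal_eq_sum_range_succ
    (fun i j => PowerSeries.coeff i (okounkovFactor s k) * PowerSeries.coeff j f),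
    ← Finset.sum_filter]
  simp only [coeff_okounkovFactor hs hk, ite_mul, zero_mul]
  rw [← Finset.sum_filter]
  refine (Finset.sum_bij' (fun m _ => k * m) (fun u _ => u / k) ?_ ?_ ?_ ?_ ?_).symm
  · intro m hm
    simp only [Finset.mem_filter, Finset.mem_range] at hm ⊢
    exact ⟨by omega, Dvd.intro _ rfl⟩
  · intro u hu
    simp only [Finset.mem_filter, Finset.mem_range] at hu ⊢
    rw [Nat.mul_div_cancel' hu.2]
    exact ⟨(Nat.div_le_self u k).trans_lt hu.1, by omega⟩
  · intro m _
    exact Nat.mul_div_cancel_left m (Nat.pos_of_ne_zero hk)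
  · intro u hu
    exact Nat.mul_div_cancel' (Finset.mem_filter.1 hu).2
  · intro m _
    rw [Nat.mul_div_cancel_left m (Nat.pos_of_ne_zero hk)]

/-! ### Nested sums as finite, computable recursions -/

/-- The sum of the terms of `okounkovQMZV` with `K > k₁ > ⋯ > k_d > 0`. -/
noncomputable def truncQMZV : List ℕ → ℕ → PowerSeries ℚ
  | [], _ => 1
  | s :: t, K => ∑ k ∈ Finset.Ico 1 K, okounkovFactor s k * truncQMZV t k

/-- The tuples `K > k₁ > ⋯ > k_d > 0`. -/
def nestedBelow (d K : ℕ) : Finset (Fin d → ℕ) :=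
  (Fintype.piFinset fun _ => Finset.Ico 1 K).filter fun k => ∀ i j, i < j → k j < k i

lemma mem_nestedBelow {d K : ℕ} {k : Fin d → ℕ} :
    k ∈ nestedBelow d K ↔ (∀ j, 0 < k j ∧ k j < K) ∧ StrictAnti k := by
  simp only [nestedBelow, Finset.mem_filter, Fintype.mem_piFinset, Finset.mem_Ico,
    Nat.succ_le_iff]
  rfl

lemma cons_mem_nestedBelow {d K a : ℕ} {k : Fin d → ℕ} :
    (Fin.cons a k : Fin (d + 1) → ℕ) ∈ nestedBelow (d + 1) K ↔
      a ∈ Finset.Ico 1 K ∧ k ∈ nestedBelow d a := by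
  simp only [mem_nestedBelow, Finset.mem_Ico, Nat.succ_le_iff]
  constructor
  · rintro ⟨h0, h1⟩
    exact ⟨h0 0, fun j => ⟨(h0 j.succ).1, h1 (Fin.succ_pos j)⟩,
      fun i j hij => h1 (Fin.succ_lt_succ_iff.2 hij)⟩
  · rintro ⟨ha, h0, h1⟩
    refine ⟨Fin.cases ha fun j => ⟨(h0 j).1, (h0 j).2.trans ha.2⟩, fun i j hij => ?_⟩
    induction j using Fin.cases with
    | zero => exact absurd hij (Fin.not_lt_zero i)
    | succ j =>
      induction i using Fin.cases with
      | zero => exact (h0 j).2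
      | succ i => exact h1 (Fin.succ_lt_succ_iff.1 hij)

/-- Peel off the largest index `k₁`; the remaining tuple ranges over `nestedBelow d k₁`. -/
lemma sum_nestedBelow_prod (d : ℕ) (s : Fin d → ℕ) (K : ℕ) :
    ∑ k ∈ nestedBelow d K, ∏ j, okounkovFactor (s j) (k j) = truncQMZV (List.ofFn s) K := by
  induction d generalizing K with
  | zero =>
    have : nestedBelow 0 K = {Fin.elim0} := by
      ext k
      simp [mem_nestedBelow, StrictAnti, Subsingleton.elim k Fin.elim0]
    simp [this, truncQMZV]
  | succ d ih =>
    rw [List.ofFn_succ, truncQMZV]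
    simp only [← ih, Finset.mul_sum]
    rw [Finset.sum_sigma']
    refine Finset.sum_bij' (fun k _ => ⟨k 0, Fin.tail k⟩) (fun p _ => Fin.cons p.1 p.2) ?_ ?_ ?_ ?_ ?_
    · intro k hk
      rw [← Fin.cons_self_tail k, cons_mem_nestedBelow] at hk
      exact Finset.mem_sigma.2 hk
    · intro p hp
      exact cons_mem_nestedBelow.2 (Finset.mem_sigma.1 hp)
    · intro k _
      exact Fin.cons_self_tail k
    · intro p _
      rfl
    · intro k _
      rw [Fin.prod_univ_succ]
      rfl

lemma okounkovTerm_eq_prod {d : ℕ} (s : Fin d → ℕ) (k : NestedIndex d) :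
    okounkovTerm s k = ∏ j, okounkovFactor (s j) (k.1 j) := rfl

lemma coeff_okounkovTerm_eq_zero {d : ℕ} {s : Fin d → ℕ} (hs : ∀ j, 2 ≤ s j)
    {k : NestedIndex d} {j : Fin d} {n : ℕ} (hj : n < k.1 j) :
    PowerSeries.coeff n (okounkovTerm s k) = 0 := by
  have hlow : 1 ≤ lowerHalf (s j) := by have := hs j; unfold lowerHalf; omega
  have hup : 1 ≤ upperHalf (s j) := by have := hs j; unfold upperHalf; omega
  have hdvd : (PowerSeries.X : PowerSeries ℚ) ^ (k.1 j) ∣ okounkovTerm s k :=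
    dvd_trans (Dvd.dvd.mul_right (dvd_add (pow_dvd_pow _ (Nat.le_mul_of_pos_right _ hup))
      (pow_dvd_pow _ (Nat.le_mul_of_pos_right _ hlow))) _)
      (Finset.dvd_prod_of_mem _ (Finset.mem_univ j))
  exact PowerSeries.X_pow_dvd_iff.1 hdvd n hj

/-- A term with some `kⱼ > n` is divisible by `q^(n+1)`, so truncating at `K = n + 1` loses nothing.
-/
lemma coeff_okounkovQMZV {d : ℕ} {s : Fin d → ℕ} (hs : ∀ j, 2 ≤ s j) (n : ℕ) :
    PowerSeries.coeff n (okounkovQMZV s) =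
      PowerSeries.coeff n (truncQMZV (List.ofFn s) (n + 1)) := by
  have h1 := ((PowerSeries.WithPiTopology.hasSum_iff_hasSum_coeff ℚ).1
    (summable_okounkovTerm s hs).hasSum) n
  have h2 : HasSum (fun k : NestedIndex d => PowerSeries.coeff n (okounkovTerm s k))
      (∑ k ∈ (nestedBelow d (n + 1)).subtype (fun k => StrictAnti k ∧ ∀ j, 0 < k j),
        PowerSeries.coeff n (okounkovTerm s k)) := by
    refine hasSum_sum_of_ne_finset_zero fun k hk => ?_
    simp only [Finset.mem_subtype, mem_nestedBelow, not_and] at hk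
    by_contra hne
    refine hk (fun j => ⟨k.2.2 j, ?_⟩) k.2.1
    by_contra hj
    exact hne (coeff_okounkovTerm_eq_zero hs (j := j) (by omega))
  rw [okounkovQMZV, h1.unique h2, ← sum_nestedBelow_prod, map_sum]
  have h3 := Finset.sum_subtype_of_mem (s := nestedBelow d (n + 1))
    (p := fun k : Fin d → ℕ => StrictAnti k ∧ ∀ j, 0 < k j)
    (fun k => PowerSeries.coeff n (∏ j, okounkovFactor (s j) (k j)))
    fun k hk => ⟨(mem_nestedBelow.1 hk).2, fun j => ((mem_nestedBelow.1 hk).1 j).1⟩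
  rw [← h3]
  refine Finset.sum_congr rfl fun k _ => ?_
  rw [okounkovTerm_eq_prod]

/-- The coefficient of `q ^ n` in `truncQMZV l K`. -/
def truncCoeff : List ℕ → ℕ → ℕ → ℕ
  | [], _, n => if n = 0 then 1 else 0
  | s :: t, K, n => ∑ k ∈ Finset.Ico 1 K, ∑ m ∈ Finset.range (n + 1),
      if k * m ≤ n then factorCoeff s m * truncCoeff t k (n - k * m) else 0

lemma coeff_truncQMZV (l : List ℕ) (hl : ∀ s ∈ l, 2 ≤ s) (K n : ℕ) :
    PowerSeries.coeff n (truncQMZV l K) = truncCoeff l K n := by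
  induction l generalizing K n with
  | nil => simp [truncQMZV, truncCoeff, PowerSeries.coeff_one]
  | cons s t ih =>
    rw [truncQMZV, truncCoeff, map_sum, Nat.cast_sum]
    refine Finset.sum_congr rfl fun k hk => ?_
    rw [coeff_okounkovFactor_mul (hl s (by simp)) (by have := Finset.mem_Ico.1 hk; omega)]
    simp only [ih fun s hs => hl s (List.mem_cons_of_mem _ hs)]
    push_cast
    rfl

lemma coeff_okounkovQMZV_eq_truncCoeff {d : ℕ} {s : Fin d → ℕ} (hs : ∀ j, 2 ≤ s j) (n : ℕ) :
    PowerSeries.coeff n (okounkovQMZV s) = truncCoeff (List.ofFn s) (n + 1) n := by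
  rw [coeff_okounkovQMZV hs, coeff_truncQMZV _ (by simpa [List.mem_ofFn] using hs)]

/-! ### Depth one and two as sums over products -/

lemma factorCoeff_zero {s : ℕ} (hs : 2 ≤ s) : factorCoeff s 0 = 0 := by
  unfold factorCoeff upperHalf lowerHalf
  rw [Nat.choose_eq_zero_of_lt (by omega), Nat.choose_eq_zero_of_lt (by omega)]

/-- The quadruples `(k, m, l, n)` of positive integers with `k * m + l * n = N`. -/
def twoProducts (N : ℕ) : Finset (ℕ × ℕ × ℕ × ℕ) :=
  (Finset.Icc 1 N ×ˢ Finset.Icc 1 N ×ˢ Finset.Icc 1 N ×ˢ Finset.Icc 1 N).filter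
    fun x => x.1 * x.2.1 + x.2.2.1 * x.2.2.2 = N

lemma mem_twoProducts {N : ℕ} {x : ℕ × ℕ × ℕ × ℕ} :
    x ∈ twoProducts N ↔ (0 < x.1 ∧ 0 < x.2.1 ∧ 0 < x.2.2.1 ∧ 0 < x.2.2.2) ∧
      x.1 * x.2.1 + x.2.2.1 * x.2.2.2 = N := by
  obtain ⟨k, m, l, n⟩ := x
  simp only [twoProducts, Finset.mem_filter, Finset.mem_product, Finset.mem_Icc]
  constructor
  · rintro ⟨⟨h1, h2, h3, h4⟩, h⟩
    exact ⟨⟨h1.1, h2.1, h3.1, h4.1⟩, h⟩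
  · rintro ⟨⟨h1, h2, h3, h4⟩, rfl⟩
    have := Nat.le_mul_of_pos_right k h2
    have := Nat.le_mul_of_pos_left m h1
    have := Nat.le_mul_of_pos_right l h4
    have := Nat.le_mul_of_pos_left n h3
    refine ⟨⟨⟨h1, ?_⟩, ⟨h2, ?_⟩, ⟨h3, ?_⟩, ⟨h4, ?_⟩⟩, rfl⟩ <;> omega

/-- `m = 0` drops out since the factor has no constant term. The bound `N` is independent of `M`, so
that the inner sums of depth two share one range. -/
lemma truncCoeff_singleton {s : ℕ} (hs : 2 ≤ s) {K M N : ℕ} (hM : M ≤ N) :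
    truncCoeff [s] K M = ∑ k ∈ Finset.Ico 1 K, ∑ m ∈ Finset.Icc 1 N,
      if k * m = M then factorCoeff s m else 0 := by
  simp only [truncCoeff]
  refine Finset.sum_congr rfl fun k hk => ?_
  rw [← Finset.sum_filter, ← Finset.sum_filter]
  refine (Finset.sum_subset_zero_on_sdiff ?_ ?_ ?_).symm
  · intro m hm
    simp only [Finset.mem_filter, Finset.mem_Icc, Finset.mem_range] at hm ⊢
    have := Nat.le_mul_of_pos_left m (Finset.mem_Ico.1 hk).1
    omega
  · intro m hm
    simp only [Finset.mem_sdiff, Finset.mem_filter, Finset.mem_Icc, Finset.mem_range] at hm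
    rcases Nat.eq_zero_or_pos m with rfl | hm0
    · simp [factorCoeff_zero hs]
    · have : ¬ M - k * m = 0 := fun h => hm.2 ⟨⟨hm0, by omega⟩, by omega⟩
      simp [this]
  · intro m hm
    simp only [Finset.mem_filter] at hm
    simp [hm.2]

lemma truncCoeff_pair {a b : ℕ} (ha : 2 ≤ a) (hb : 2 ≤ b) (N : ℕ) :
    truncCoeff [a, b] (N + 1) N = ∑ x ∈ (twoProducts N).filter (fun x => x.2.2.1 < x.1),
      factorCoeff a x.2.1 * factorCoeff b x.2.2.2 := by
  rw [twoProducts, Finset.filter_filter, Finset.sum_filter, Finset.sum_product, truncCoeff]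
  refine Finset.sum_congr (by ext; simp) fun k hk => ?_
  rw [Finset.sum_product, ← Finset.sum_subset (s₁ := Finset.Icc 1 N)]
  · refine Finset.sum_congr rfl fun m _ => ?_
    rw [Finset.sum_product]
    by_cases hkm : k * m ≤ N
    · rw [if_pos hkm, truncCoeff_singleton hb (Nat.sub_le N (k * m)), Finset.mul_sum]
      have hIco : Finset.Ico 1 k = (Finset.Icc 1 N).filter (fun l => l < k) := by
        ext l
        simp only [Finset.mem_Ico, Finset.mem_filter, Finset.mem_Icc] at hk ⊢
        omega
      rw [hIco, Finset.sum_filter]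
      refine Finset.sum_congr rfl fun l _ => ?_
      by_cases hlk : l < k
      · rw [if_pos hlk, Finset.mul_sum]
        refine Finset.sum_congr rfl fun n _ => ?_
        rw [mul_ite, mul_zero]
        refine if_congr ?_ rfl rfl
        simp only [hlk, and_true]
        omega
      · simp [hlk]
    · rw [if_neg hkm]
      refine (Finset.sum_eq_zero fun l _ => Finset.sum_eq_zero fun n _ => if_neg ?_).symm
      rintro ⟨h, -⟩
      simp only at h
      omega
  · intro m hm
    simp only [Finset.mem_range, Finset.mem_Icc] at hm ⊢
    omega
  · intro m hm hm'
    have : m = 0 := by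
      simp only [Finset.mem_range, Finset.mem_Icc] at hm hm'
      omega
    simp [this, factorCoeff_zero ha]

section TwoProducts

variable (N : ℕ) (H : ℕ → ℕ → ℚ)

/-- Reindexing by `km + ln = (k - l)m + l(m + n)`. -/
lemma sum_twoProducts_add_lt :
    ∑ x ∈ (twoProducts N).filter (fun x => x.2.2.1 < x.1), H x.2.1 (x.2.1 + x.2.2.2) =
      ∑ x ∈ (twoProducts N).filter (fun x => x.2.1 < x.2.2.2), H x.2.1 x.2.2.2 := by
  refine Finset.sum_bij' (fun x _ => (x.1 - x.2.2.1, x.2.1, x.2.2.1, x.2.1 + x.2.2.2))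
    (fun x _ => (x.1 + x.2.2.1, x.2.1, x.2.2.1, x.2.2.2 - x.2.1)) ?_ ?_ ?_ ?_ ?_
  · rintro ⟨k, m, l, n⟩ hx
    simp only [Finset.mem_filter, mem_twoProducts] at hx ⊢
    obtain ⟨⟨⟨h1, h2, h3, h4⟩, h⟩, hlt⟩ := hx
    obtain ⟨j, rfl⟩ := Nat.exists_eq_add_of_lt hlt
    refine ⟨⟨⟨by omega, h2, h3, by omega⟩, ?_⟩, by omega⟩
    rw [← h, show l + j + 1 - l = j + 1 by omega]
    ring
  · rintro ⟨k, m, l, n⟩ hx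
    simp only [Finset.mem_filter, mem_twoProducts] at hx ⊢
    obtain ⟨⟨⟨h1, h2, h3, h4⟩, h⟩, hlt⟩ := hx
    obtain ⟨j, rfl⟩ := Nat.exists_eq_add_of_lt hlt
    refine ⟨⟨⟨by omega, h2, h3, by omega⟩, ?_⟩, by omega⟩
    rw [← h, show m + j + 1 - m = j + 1 by omega]
    ring
  · rintro ⟨k, m, l, n⟩ hx
    simp only [Finset.mem_filter] at hx
    simp only [Prod.mk.injEq, true_and]
    omega
  · rintro ⟨k, m, l, n⟩ hx
    simp only [Finset.mem_filter] at hx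
    simp only [Prod.mk.injEq, true_and]
    omega
  · intro x _
    rfl

variable {H}

lemma sum_twoProducts_swap (hH : ∀ m n, H m n = H n m) (p : ℕ × ℕ × ℕ × ℕ → Prop)
    [DecidablePred p] :
    ∑ x ∈ (twoProducts N).filter p, H x.2.1 x.2.2.2 =
      ∑ x ∈ (twoProducts N).filter (fun x => p (x.2.2.1, x.2.2.2, x.1, x.2.1)),
        H x.2.1 x.2.2.2 := by
  refine Finset.sum_bij' (fun x _ => (x.2.2.1, x.2.2.2, x.1, x.2.1))
    (fun x _ => (x.2.2.1, x.2.2.2, x.1, x.2.1)) ?_ ?_ ?_ ?_ ?_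
  · rintro ⟨k, m, l, n⟩ hx
    simp only [Finset.mem_filter, mem_twoProducts] at hx ⊢
    exact ⟨⟨⟨hx.1.1.2.2.1, hx.1.1.2.2.2, hx.1.1.1, hx.1.1.2.1⟩, by rw [add_comm]; exact hx.1.2⟩,
      hx.2⟩
  · rintro ⟨k, m, l, n⟩ hx
    simp only [Finset.mem_filter, mem_twoProducts] at hx ⊢
    exact ⟨⟨⟨hx.1.1.2.2.1, hx.1.1.2.2.2, hx.1.1.1, hx.1.1.2.1⟩, by rw [add_comm]; exact hx.1.2⟩,
      hx.2⟩
  · intro x _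
    rfl
  · intro x _
    rfl
  · intro x _
    exact hH _ _

lemma sum_trichotomy {ι : Type*} (s : Finset ι) (u v : ι → ℕ) (f : ι → ℚ) :
    ∑ x ∈ s, f x = ∑ x ∈ s.filter (fun x => u x < v x), f x +
      ∑ x ∈ s.filter (fun x => v x < u x), f x + ∑ x ∈ s.filter (fun x => u x = v x), f x := by
  simp only [Finset.sum_filter, ← Finset.sum_add_distrib]
  refine Finset.sum_congr rfl fun x _ => ?_
  rcases lt_trichotomy (u x) (v x) with h | h | h
  · simp [h, h.ne, h.le.not_gt]
  · simp [h]
  · simp [h, h.ne', h.le.not_gt]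

/-- Summing a symmetric function of `(m, n)` over `k * m + l * n = N` by comparing `k` with `l`,
or `m` with `n`. -/
lemma two_mul_sum_sub_add (hH : ∀ m n, H m n = H n m) :
    2 * ∑ x ∈ (twoProducts N).filter (fun x => x.2.2.1 < x.1),
        (H x.2.1 x.2.2.2 - H x.2.1 (x.2.1 + x.2.2.2)) =
      ∑ x ∈ (twoProducts N).filter (fun x => x.2.1 = x.2.2.2), H x.2.1 x.2.2.2 -
        ∑ x ∈ (twoProducts N).filter (fun x => x.2.2.1 = x.1), H x.2.1 x.2.2.2 := by
  rw [Finset.sum_sub_distrib, sum_twoProducts_add_lt]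
  -- Both splittings have the same total, and in each the two strict parts agree by symmetry of `H`.
  have h1 := sum_trichotomy (twoProducts N) (fun x => x.2.2.1) (fun x => x.1)
    (fun x => H x.2.1 x.2.2.2)
  have h2 := sum_trichotomy (twoProducts N) (fun x => x.2.1) (fun x => x.2.2.2)
    (fun x => H x.2.1 x.2.2.2)
  have h3 := sum_twoProducts_swap N hH (fun x => x.1 < x.2.2.1)
  have h4 := sum_twoProducts_swap N hH (fun x => x.2.2.2 < x.2.1)
  simp only at h1 h2 h3 h4
  linarith

variable (H)

/-- When `k = l` the equation reads `k(m + n) = N`; grouping by `s = m + n` gives the shape of a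
depth-one coefficient. -/
lemma sum_twoProducts_eq :
    ∑ x ∈ (twoProducts N).filter (fun x => x.2.2.1 = x.1), H x.2.1 x.2.2.2 =
      ∑ k ∈ Finset.Ico 1 (N + 1), ∑ s ∈ Finset.Icc 1 N,
        if k * s = N then ∑ m ∈ Finset.Ico 1 s, H m (s - m) else 0 := by
  simp only [← Finset.sum_filter]
  rw [Finset.sum_sigma', Finset.sum_sigma']
  refine Finset.sum_bij' (fun x _ => ⟨⟨x.1, x.2.1 + x.2.2.2⟩, x.2.1⟩)
    (fun y _ => (y.1.1, y.2, y.1.1, y.1.2 - y.2)) ?_ ?_ ?_ ?_ ?_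
  · rintro ⟨k, m, l, n⟩ hx
    simp only [Finset.mem_filter, mem_twoProducts] at hx
    obtain ⟨⟨⟨h1, h2, h3, h4⟩, h⟩, rfl⟩ := hx
    rw [← mul_add] at h
    have := Nat.le_mul_of_pos_right l (show 0 < m + n by omega)
    have := Nat.le_mul_of_pos_left (m + n) h1
    simp only [Finset.mem_sigma, Finset.mem_Ico, Finset.mem_filter, Finset.mem_Icc]
    omega
  · rintro ⟨⟨k, s⟩, m⟩ hy
    simp only [Finset.mem_sigma, Finset.mem_Ico, Finset.mem_filter, Finset.mem_Icc] at hy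
    simp only [Finset.mem_filter, mem_twoProducts, ← mul_add,
      Nat.add_sub_cancel' hy.2.2.le, and_true]
    omega
  · rintro ⟨k, m, l, n⟩ hx
    simp only [Finset.mem_filter] at hx
    simp only [Prod.mk.injEq, true_and]
    omega
  · rintro ⟨⟨k, s⟩, m⟩ hy
    simp only [Finset.mem_sigma, Finset.mem_Ico] at hy
    simp only [Nat.add_sub_cancel' hy.2.2.le]
  · rintro ⟨k, m, l, n⟩ _
    simp

end TwoProducts

/-! ### Polynomial identities -/

lemma cast_choose_three (m : ℕ) : (m.choose 3 : ℚ) = m * (m - 1) * (m - 2) / 6 := by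
  induction m with
  | zero => simp
  | succ m ih =>
    rw [Nat.choose_succ_succ, Nat.cast_add, ih, Nat.cast_choose_two]
    push_cast
    ring

lemma cast_choose_four (m : ℕ) : (m.choose 4 : ℚ) = m * (m - 1) * (m - 2) * (m - 3) / 24 := by
  induction m with
  | zero => simp
  | succ m ih =>
    rw [Nat.choose_succ_succ, Nat.cast_add, ih, cast_choose_three]
    push_cast
    ring

lemma cast_choose_five (m : ℕ) :
    (m.choose 5 : ℚ) = m * (m - 1) * (m - 2) * (m - 3) * (m - 4) / 120 := by
  induction m with
  | zero => simp
  | succ m ih =>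
    rw [Nat.choose_succ_succ, Nat.cast_add, ih, cast_choose_four]
    push_cast
    ring

lemma factorCoeff_two (m : ℕ) : (factorCoeff 2 m : ℚ) = 2 * m := by
  simp [factorCoeff, upperHalf, lowerHalf]
  ring

lemma factorCoeff_three (m : ℕ) : (factorCoeff 3 m : ℚ) = m ^ 2 := by
  simp [factorCoeff, upperHalf, lowerHalf, Nat.cast_choose_two]
  ring

lemma factorCoeff_four (m : ℕ) : (factorCoeff 4 m : ℚ) = (m ^ 3 - m) / 3 := by
  simp [factorCoeff, upperHalf, lowerHalf, cast_choose_three]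
  ring

lemma factorCoeff_six (m : ℕ) : (factorCoeff 6 m : ℚ) = (m ^ 5 - 5 * m ^ 3 + 4 * m) / 60 := by
  simp [factorCoeff, upperHalf, lowerHalf, cast_choose_five]
  ring

/-- Power sums applied to `t³m - 5t²m² + 8tm³ - 4m⁴`. Keeping `t` separate from `n` lets the
induction run; `t = n` is used afterwards. -/
lemma sum_range_quartic (t : ℚ) (n : ℕ) :
    ∑ m ∈ Finset.range n, (m : ℚ) * (t - m) * (t - 2 * m) ^ 2 =
      t ^ 3 * (n * (n - 1) / 2) - 5 * t ^ 2 * (n * (n - 1) * (2 * n - 1) / 6) +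
        8 * t * (n * (n - 1) / 2) ^ 2 -
        4 * (n * (n - 1) * (2 * n - 1) * (3 * n ^ 2 - 3 * n - 1) / 30) := by
  induction n with
  | zero => simp
  | succ n ih =>
    rw [Finset.sum_range_succ, ih]
    push_cast
    ring

lemma sum_Ico_quartic (s : ℕ) :
    ∑ m ∈ Finset.Ico 1 s, (2 * (m : ℚ) ^ 2 * ((s - m : ℕ) : ℚ) ^ 2 -
        (m : ℚ) ^ 3 * ((s - m : ℕ) : ℚ) - m * ((s - m : ℕ) : ℚ) ^ 3) =
      -(2 * (factorCoeff 6 s : ℚ)) := by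
  have h := sum_range_quartic s s
  rw [Finset.range_eq_Ico] at h
  rcases Nat.eq_zero_or_pos s with rfl | hs
  · simp [factorCoeff_six]
  rw [Finset.sum_eq_sum_Ico_succ_bot hs] at h
  have h2 : ∑ m ∈ Finset.Ico 1 s, (2 * (m : ℚ) ^ 2 * ((s - m : ℕ) : ℚ) ^ 2 -
        (m : ℚ) ^ 3 * ((s - m : ℕ) : ℚ) - m * ((s - m : ℕ) : ℚ) ^ 3) =
      -∑ m ∈ Finset.Ico 1 s, (m : ℚ) * (s - m) * (s - 2 * m) ^ 2 := by
    rw [← Finset.sum_neg_distrib]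
    refine Finset.sum_congr rfl fun m hm => ?_
    rw [Nat.cast_sub (Finset.mem_Ico.1 hm).2.le]
    ring
  rw [h2, factorCoeff_six]
  simp only [zero_add, Nat.cast_zero, zero_mul] at h
  rw [h]
  ring

/-! ### The weight-six relation -/

theorem okounkovQMZV_six :
    (4 : ℚ) • okounkovQMZV ![6] =
      -okounkovQMZV ![2, 2] + (12 : ℚ) • okounkovQMZV ![3, 3] -
        (6 : ℚ) • okounkovQMZV ![4, 2] := by
  ext N
  have h6 : PowerSeries.coeff N (okounkovQMZV ![6]) = _ :=
    coeff_okounkovQMZV_eq_truncCoeff (by simp) N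
  have h22 : PowerSeries.coeff N (okounkovQMZV ![2, 2]) = _ :=
    coeff_okounkovQMZV_eq_truncCoeff (by simp [Fin.forall_fin_two]) N
  have h33 : PowerSeries.coeff N (okounkovQMZV ![3, 3]) = _ :=
    coeff_okounkovQMZV_eq_truncCoeff (by simp [Fin.forall_fin_two]) N
  have h42 : PowerSeries.coeff N (okounkovQMZV ![4, 2]) = _ :=
    coeff_okounkovQMZV_eq_truncCoeff (by simp [Fin.forall_fin_two]) N
  simp only [map_sub, map_add, map_neg, PowerSeries.coeff_smul, smul_eq_mul, h6, h22, h33, h42]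
  have e6 : List.ofFn ![6] = [6] := rfl
  have e22 : List.ofFn ![2, 2] = [2, 2] := rfl
  have e33 : List.ofFn ![3, 3] = [3, 3] := rfl
  have e42 : List.ofFn ![4, 2] = [4, 2] := rfl
  rw [e6, e22, e33, e42, truncCoeff_pair le_rfl le_rfl, truncCoeff_pair (by norm_num) (by norm_num),
    truncCoeff_pair (by norm_num) le_rfl, truncCoeff_singleton (by norm_num) le_rfl]
  -- Here `H(m, n) - H(m, m + n) = 3m²n² - m³n`. Four times this is the summand of the right-hand
  -- side, where the `mn` terms of `[2,2]` and `[4,2]` cancel.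
  have key := two_mul_sum_sub_add N (H := fun m n => 2 * (m : ℚ) ^ 2 * (n : ℚ) ^ 2 -
    (m : ℚ) ^ 3 * n - m * (n : ℚ) ^ 3) (fun m n => by ring)
  have hdiag : ∑ x ∈ (twoProducts N).filter (fun x => x.2.1 = x.2.2.2),
      (2 * (x.2.1 : ℚ) ^ 2 * (x.2.2.2 : ℚ) ^ 2 - (x.2.1 : ℚ) ^ 3 * x.2.2.2 -
        x.2.1 * (x.2.2.2 : ℚ) ^ 3) = 0 := by
    refine Finset.sum_eq_zero fun x hx => ?_
    rw [(Finset.mem_filter.1 hx).2]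
    ring
  rw [hdiag, sum_twoProducts_eq N (fun m n => 2 * (m : ℚ) ^ 2 * (n : ℚ) ^ 2 -
    (m : ℚ) ^ 3 * n - m * (n : ℚ) ^ 3)] at key
  simp only [sum_Ico_quartic] at key
  have hsix : ∑ k ∈ Finset.Ico 1 (N + 1), ∑ s ∈ Finset.Icc 1 N,
      (if k * s = N then -(2 * (factorCoeff 6 s : ℚ)) else 0) =
      -2 * ∑ k ∈ Finset.Ico 1 (N + 1), ∑ s ∈ Finset.Icc 1 N,
        if k * s = N then (factorCoeff 6 s : ℚ) else 0 := by
    simp only [Finset.mul_sum, mul_ite, mul_zero, neg_mul]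
  rw [hsix] at key
  push_cast
  have hF : 4 * ∑ x ∈ (twoProducts N).filter (fun x => x.2.2.1 < x.1),
      ((2 * (x.2.1 : ℚ) ^ 2 * (x.2.2.2 : ℚ) ^ 2 - (x.2.1 : ℚ) ^ 3 * x.2.2.2 -
        x.2.1 * (x.2.2.2 : ℚ) ^ 3) - (2 * (x.2.1 : ℚ) ^ 2 * ((x.2.1 + x.2.2.2 : ℕ) : ℚ) ^ 2 -
        (x.2.1 : ℚ) ^ 3 * ((x.2.1 + x.2.2.2 : ℕ) : ℚ) -
        x.2.1 * ((x.2.1 + x.2.2.2 : ℕ) : ℚ) ^ 3)) =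
      -∑ x ∈ (twoProducts N).filter (fun x => x.2.2.1 < x.1),
        (factorCoeff 2 x.2.1 : ℚ) * factorCoeff 2 x.2.2.2 +
      12 * ∑ x ∈ (twoProducts N).filter (fun x => x.2.2.1 < x.1),
        (factorCoeff 3 x.2.1 : ℚ) * factorCoeff 3 x.2.2.2 -
      6 * ∑ x ∈ (twoProducts N).filter (fun x => x.2.2.1 < x.1),
        (factorCoeff 4 x.2.1 : ℚ) * factorCoeff 2 x.2.2.2 := by
    rw [Finset.mul_sum, Finset.mul_sum, Finset.mul_sum, ← Finset.sum_neg_distrib,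
      ← Finset.sum_add_distrib, ← Finset.sum_sub_distrib]
    refine Finset.sum_congr rfl fun x _ => ?_
    rw [factorCoeff_two, factorCoeff_two, factorCoeff_three, factorCoeff_three, factorCoeff_four]
    push_cast
    ring
  rw [← hF]
  linarith

/-! ### A basis in weight at most six -/

/-- The type O value of a composition given as a list. -/
noncomputable def listQMZV (l : List ℕ) : PowerSeries ℚ := okounkovQMZV l.get

lemma coeff_listQMZV {l : List ℕ} (hl : ∀ s ∈ l, 2 ≤ s) (n : ℕ) :
    PowerSeries.coeff n (listQMZV l) = truncCoeff l (n + 1) n := by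
  rw [listQMZV, coeff_okounkovQMZV_eq_truncCoeff fun j => hl _ (List.get_mem l j), List.ofFn_get]

lemma okounkovQMZV_eq_listQMZV {d : ℕ} {s : Fin d → ℕ} (hs : ∀ j, 2 ≤ s j) :
    okounkovQMZV s = listQMZV (List.ofFn s) := by
  ext n
  rw [coeff_okounkovQMZV_eq_truncCoeff hs, coeff_listQMZV (by simpa [List.mem_ofFn] using hs)]

/-- The compositions of weight at most `6` with parts at least `2`, except `[6]`. -/
def basisIndex : Fin 11 → List ℕ :=
  ![[2], [3], [4], [2, 2], [5], [3, 2], [2, 3], [4, 2], [2, 4], [3, 3], [2, 2, 2]]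

lemma two_le_of_mem_basisIndex (i : Fin 11) : ∀ s ∈ basisIndex i, 2 ≤ s := by
  revert i
  decide

/-- The coefficients of `q, …, q ^ 11` in the series indexed by `basisIndex`. -/
def basisCoeff : Fin 11 → Fin 11 → ℕ :=
  ![
    ![2, 1, 0, 0, 0, 0, 0, 0, 0, 0, 0],
    ![6, 5, 2, 0, 1, 0, 0, 0, 0, 0, 0],
    ![8, 10, 8, 4, 6, 2, 2, 0, 0, 1, 0],
    ![14, 21, 22, 12, 21, 6, 10, 0, 4, 5, 0],
    ![12, 26, 40, 36, 50, 22, 34, 4, 20, 19, 0],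
    ![24, 50, 80, 60, 112, 38, 78, 8, 68, 47, 8],
    ![16, 50, 112, 120, 196, 88, 168, 32, 176, 110, 24],
    ![30, 85, 190, 180, 357, 142, 302, 60, 384, 217, 72],
    ![26, 91, 248, 268, 546, 230, 514, 124, 764, 393, 176],
    ![36, 130, 372, 396, 876, 366, 826, 220, 1376, 685, 336],
    ![24, 122, 440, 540, 1210, 546, 1246, 396, 2340, 1101, 648]]

lemma truncCoeff_basisIndex (n i : Fin 11) :
    truncCoeff (basisIndex i) (n + 2) (n + 1) = basisCoeff n i := by
  revert n i
  decide +kernel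

lemma linearIndependent_listQMZV_basisIndex :
    LinearIndependent ℚ fun i => listQMZV (basisIndex i) := by
  rw [Fintype.linearIndependent_iff]
  intro g hg
  have h : ∀ n : Fin 11, ∑ i, g i * (basisCoeff n i : ℚ) = 0 := by
    intro n
    have := congrArg (PowerSeries.coeff (n + 1 : ℕ)) hg
    simpa only [map_sum, PowerSeries.coeff_smul, smul_eq_mul, map_zero,
      coeff_listQMZV (two_le_of_mem_basisIndex _), truncCoeff_basisIndex] using this
  simp only [Fin.forall_fin_succ, Fin.sum_univ_succ, basisCoeff] at h
  simp at h
  obtain ⟨h1, h2, h3, h4, h5, h6, h7, h8, h9, h10, h11⟩ := h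
  intro i
  -- `linarith` inverts the system, finding for each unknown a combination of the eleven equations.
  fin_cases i <;> simp <;> linarith

lemma exists_basisIndex_eq {l : List ℕ} (hne : l ≠ []) (hl : ∀ s ∈ l, 2 ≤ s) (hsum : l.sum ≤ 6) :
    (∃ i, basisIndex i = l) ∨ l = [6] := by
  match l, hne, hl, hsum with
  | [a], _, hl, hsum =>
    simp only [List.mem_singleton, forall_eq, List.sum_singleton] at hl hsum
    interval_cases a <;> decide
  | [a, b], _, hl, hsum =>
    simp only [List.forall_mem_cons, List.sum_cons, List.sum_nil] at hl hsum
    obtain ⟨ha, hb, -⟩ := hl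
    have : a ≤ 4 := by omega
    have : b ≤ 4 := by omega
    interval_cases a <;> interval_cases b <;> first | omega | decide
  | [a, b, c], _, hl, hsum =>
    simp only [List.forall_mem_cons, List.sum_cons, List.sum_nil] at hl hsum
    obtain ⟨ha, hb, hc, -⟩ := hl
    obtain rfl : a = 2 := by omega
    obtain rfl : b = 2 := by omega
    obtain rfl : c = 2 := by omega
    decide
  | a :: b :: c :: d :: t, _, hl, hsum =>
    simp only [List.forall_mem_cons, List.sum_cons] at hl hsum
    omega

lemma listQMZV_six : listQMZV [6] =
    (-(1 / 4) : ℚ) • listQMZV [2, 2] + (3 : ℚ) • listQMZV [3, 3] -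
      (3 / 2 : ℚ) • listQMZV [4, 2] := by
  have h := okounkovQMZV_six
  rw [okounkovQMZV_eq_listQMZV (s := ![6]) (by simp),
    okounkovQMZV_eq_listQMZV (s := ![2, 2]) (by simp [Fin.forall_fin_two]),
    okounkovQMZV_eq_listQMZV (s := ![3, 3]) (by simp [Fin.forall_fin_two]),
    okounkovQMZV_eq_listQMZV (s := ![4, 2]) (by simp [Fin.forall_fin_two])] at h
  have h' := congrArg (fun f => (1 / 4 : ℚ) • f) h
  simp only [smul_smul, smul_sub, smul_add, smul_neg] at h'
  norm_num at h'
  rw [show listQMZV [6] = _ from h']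
  norm_num

lemma okounkovSpace_eq_span {w : ℕ} (hw : w ≤ 6) :
    okounkovSpace w = Submodule.span ℚ
      (Set.range fun i : {i // (basisIndex i).sum ≤ w} => listQMZV (basisIndex i)) := by
  have hmem : ∀ i, (basisIndex i).sum ≤ w → listQMZV (basisIndex i) ∈ Submodule.span ℚ
      (Set.range fun i : {i // (basisIndex i).sum ≤ w} => listQMZV (basisIndex i)) :=
    fun i hi => Submodule.subset_span ⟨⟨i, hi⟩, rfl⟩
  apply le_antisymm
  · refine Submodule.span_le.2 ?_
    rintro f ⟨d, s, hd, hs, hsum, rfl⟩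
    rw [okounkovQMZV_eq_listQMZV hs]
    have hsum' : (List.ofFn s).sum ≤ w := by rwa [List.sum_ofFn]
    rcases exists_basisIndex_eq (l := List.ofFn s) (by simp [List.ofFn_eq_nil_iff]; omega)
      (by simpa [List.mem_ofFn] using hs) (hsum'.trans hw) with ⟨i, hi⟩ | h6
    · rw [← hi] at hsum' ⊢
      exact hmem i hsum'
    · rw [h6] at hsum' ⊢
      simp only [List.sum_singleton] at hsum'
      rw [listQMZV_six]
      -- Positions 3, 9, 7 hold `[2,2]`, `[3,3]`, `[4,2]`, all of weight at most `6 ≤ w`.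
      exact sub_mem (add_mem (Submodule.smul_mem _ _ (hmem 3 (le_trans (by decide) hsum')))
        (Submodule.smul_mem _ _ (hmem 9 (le_trans (by decide) hsum'))))
        (Submodule.smul_mem _ _ (hmem 7 (le_trans (by decide) hsum')))
  · refine Submodule.span_le.2 ?_
    rintro _ ⟨⟨i, hi⟩, rfl⟩
    refine Submodule.subset_span ⟨_, (basisIndex i).get, ?_, fun j =>
      two_le_of_mem_basisIndex i _ (List.get_mem _ j), ?_, rfl⟩
    · have hpos : ∀ i, 0 < (basisIndex i).length := by decide
      exact hpos i
    · rwa [← List.sum_ofFn, List.ofFn_get]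

lemma finrank_okounkovSpace {w : ℕ} (hw : w ≤ 6) :
    Module.finrank ℚ (okounkovSpace w) = Fintype.card {i // (basisIndex i).sum ≤ w} := by
  rw [okounkovSpace_eq_span hw]
  exact finrank_span_eq_card
    (linearIndependent_listQMZV_basisIndex.comp _ Subtype.val_injective)

/-! ### The generating series -/

open PowerSeries in
lemma coeff_okounkovSeries {w : ℕ} (hw : w ≤ 6) :
    coeff w okounkovSeries =
      coeff w (X ^ 2 + 2 * X ^ 3 + 4 * X ^ 4 + 7 * X ^ 5 + 11 * X ^ 6 : PowerSeries ℚ) := by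
  have h1 : (1 - X - X ^ 2 + X ^ 6 + X ^ 8 - X ^ 13 : PowerSeries ℚ) *
      (1 - X - X ^ 2 + X ^ 6 + X ^ 8 - X ^ 13 : PowerSeries ℚ)⁻¹ = 1 :=
    PowerSeries.mul_inv_cancel _ (by simp)
  have h2 : (1 - X : PowerSeries ℚ) * (1 - X : PowerSeries ℚ)⁻¹ = 1 :=
    PowerSeries.mul_inv_cancel _ (by simp)
  have h : ∃ R : PowerSeries ℚ, okounkovSeries =
      X ^ 2 + 2 * X ^ 3 + 4 * X ^ 4 + 7 * X ^ 5 + 11 * X ^ 6 + X ^ 7 * R := by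
    -- With `D` the denominator and `A` its inverse modulo `X^7` (the first multiplier below), `A *
    -- D = 1 + X^7 * B`; the polynomial here is `B`, and `D⁻¹ = A - X^7 * B * D⁻¹`.
    refine ⟨-(-19 - 9 * X + 4 * X ^ 2 + 7 * X ^ 3 + 11 * X ^ 4 + 17 * X ^ 5 + 7 * X ^ 6 +
      11 * X ^ 7 - 2 * X ^ 8 - 3 * X ^ 9 - 5 * X ^ 10 - 8 * X ^ 11 - 12 * X ^ 12) *
      (1 - X - X ^ 2 + X ^ 6 + X ^ 8 - X ^ 13)⁻¹ - (1 - X)⁻¹, ?_⟩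
    unfold okounkovSeries
    linear_combination (1 + X + 2 * X ^ 2 + 3 * X ^ 3 + 5 * X ^ 4 + 8 * X ^ 5 + 12 * X ^ 6) * h1 -
      (1 + X + X ^ 2 + X ^ 3 + X ^ 4 + X ^ 5 + X ^ 6) * h2
  obtain ⟨R, hR⟩ := h
  rw [hR, map_add, coeff_X_pow_mul', if_neg (by omega), add_zero]

theorem mainTheorem9 :
    (∀ w : ℕ, w ≤ 6 →
      Module.Finite ℚ (okounkovSpace w) ∧
      (Module.finrank ℚ (okounkovSpace w) : ℚ) = PowerSeries.coeff w okounkovSeries) ∧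
    (4 : ℚ) • okounkovQMZV ![6] =
      -okounkovQMZV ![2, 2] + (12 : ℚ) • okounkovQMZV ![3, 3] - (6 : ℚ) • okounkovQMZV ![4, 2] := by
  refine ⟨fun w hw => ⟨?_, ?_⟩, okounkovQMZV_six⟩
  · rw [okounkovSpace_eq_span hw]
    exact Module.Finite.span_of_finite ℚ (Set.finite_range _)
  · rw [finrank_okounkovSpace hw, coeff_okounkovSeries hw]
    have hcard : ∀ v : Fin 7, Fintype.card {i // (basisIndex i).sum ≤ v} =
        (![0, 0, 1, 2, 4, 7, 11] : Fin 7 → ℕ) v := by decide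
    rw [hcard ⟨w, by omega⟩, show (2 : PowerSeries ℚ) = PowerSeries.C 2 from rfl,
      show (4 : PowerSeries ℚ) = PowerSeries.C 4 from rfl,
      show (7 : PowerSeries ℚ) = PowerSeries.C 7 from rfl,
      show (11 : PowerSeries ℚ) = PowerSeries.C 11 from rfl]
    simp only [map_add, PowerSeries.coeff_C_mul, PowerSeries.coeff_X_pow]
    interval_cases w <;> norm_num
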